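/- Let $\bar v>0$ and consider one object and $n=2$ bidders with values $v=(v_1,v_2)\in[0,\bar v]^2$. A direct deterministic mechanism $M$ consists of measurable $x_i:[0,\bar v]^2\to\{0,1\}$ with $x_1+x_2\le 1$ and measurable $t_i:[0,\bar v]^2\to\mathbb R$, $i=1,2$. Let $\mathcal M$ be the set of those that are dominant-strategy incentive compatible and ex post individually rational. For $m=(m_1,m_2)\in(0,\bar v)^2$ let $\Delta(m,\bar v)$ be the set of Borel probability distributions $F$ on $[0,\bar v]^2$ with $\int v_i\,dF=m_i$, $i=1,2$. A mechanism $M\in\mathcal M$ is called optimal if it attains $$\sup_{M\in\mathcal M}\ \inf_{F\in\Delta(m,\bar v)}\int (t_1(v)+t_2(v))\,dF .$$ For functions $p_1,p_2:[0,\bar v]\to[0,\bar v]$, a mechanism $M$ is said to be given by the thresholds $(p_1(v_2),p_2(v_1))$ if, for each $i$ and each $v$ (with $-i$ denoting the other bidder), $x_i(v)=1$ when $v_i>p_i(v_{-i})$, $x_i(v)=0$ when $v_i<p_i(v_{-i})$, $t_i(v)=p_i(v_{-i})x_i(v)$, and the object is sold whenever $v_i\ge p_i(v_{-i})$ for some $i$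 (ties being otherwise broken arbitrarily). Proposition. Suppose that $\sqrt{1-m_1/\bar v}+\sqrt{1-m_2/\bar v}\le 1$. Put $$\lambda_i^*=\frac{\sqrt{\bar v-m_1}+\sqrt{\bar v-m_2}}{\sqrt{\bar v-m_i}}-1,\qquad r_i^*=\frac{\lambda_i^*}{1+\lambda_i^*}\,\bar v,\qquad i=1,2.$$ Then $\lambda_1^*\lambda_2^*=1$, and a mechanism given by the thresholds $(p_1(v_2),p_2(v_1))$ is optimal if and only if the following three conditions hold for $i=1,2$: 1. $p_i(v_{-i})=r_i^*+\lambda_{-i}^*(v_{-i}-r_{-i}^*)$ for all $v_{-i}\in[r_{-i}^*,\bar v]$; 2. $p_i(v_{-i})\ge r_i^*+\lambda_{-i}^*(v_{-i}-r_{-i}^*)$ for all $v_{-i}\in[0,\bar v]$; 3. $p_i(v_{-i})\le\bigl(\lambda_1^*r_1^*+\lambda_2^*r_2^*-\lambda_{-i}^*v_{-i}\bigr)/\lambda_i^*$ for all $v_{-i}\in[0,r_{-i}^*]$. In particular, the thresholds of every optimal mechanism of this kind are affine at high values $v_{-i}\ge r_{-i}^*$. -/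

import Mathlib

open MeasureTheory
open scoped ENNReal

noncomputable section

namespace RobustAuction

/-- Value profiles of `n` bidders, that is, points of `[0, V]ⁿ`. -/
abbrev Profile (n : ℕ) (V : ℝ) : Type := Fin n → Set.Icc (0 : ℝ) V

/-- A direct deterministic mechanism: measurable allocation functions with values in `{0, 1}` that
allocate at most one object, and measurable real transfer functions (payments to the seller). -/
structure DirectMechanism (n : ℕ) (V : ℝ) where
  x : Fin n → Profile n V → ℝ
  t : Fin n → Profile n V → ℝ
  measurable_x : ∀ i, Measurable (x i)
  measurable_t : ∀ i, Measurable (t i)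
  x_zero_or_one : ∀ i v, x i v = 0 ∨ x i v = 1
  sum_x_le_one : ∀ v, ∑ i, x i v ≤ 1

namespace DirectMechanism

variable {n : ℕ} {V : ℝ}

/-- Dominant-strategy incentive compatibility: at every profile `v`, no bidder `i` gains by
reporting some `w` instead of the true value `v i`. -/
def IsDSIC (M : DirectMechanism n V) : Prop :=
  ∀ (i : Fin n) (v : Profile n V) (w : Set.Icc (0 : ℝ) V),
    (v i : ℝ) * M.x i (Function.update v i w) - M.t i (Function.update v i w)
      ≤ (v i : ℝ) * M.x i v - M.t i v

/-- Ex post individual rationality. -/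
def IsEPIR (M : DirectMechanism n V) : Prop :=
  ∀ (i : Fin n) (v : Profile n V), 0 ≤ (v i : ℝ) * M.x i v - M.t i v

/-- Total transfer collected by the seller. -/
def revenue (M : DirectMechanism n V) (v : Profile n V) : ℝ := ∑ i, M.t i v

/-- Expected revenue under the distribution `F`, as an extended real: the integral of the positive
part minus that of the negative part. (Under ex post individual rationality the revenue is bounded
above, so the first integral is finite, but the value may be `-∞`.) -/
def expectedRevenue (M : DirectMechanism n V) (F : Measure (Profile n V)) : EReal :=
  ((∫⁻ v, ENNReal.ofReal (M.revenue v) ∂F : ℝ≥0∞) : EReal)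
    - ((∫⁻ v, ENNReal.ofReal (-M.revenue v) ∂F : ℝ≥0∞) : EReal)

end DirectMechanism

/-- All Borel probability distributions on `[0, V]ⁿ` with vector of means `m`. -/
def feasibleDistributions {n : ℕ} (V : ℝ) (m : Fin n → ℝ) : Set (Measure (Profile n V)) :=
  {F | IsProbabilityMeasure F ∧ ∀ i, ∫ v, (v i : ℝ) ∂F = m i}

namespace DirectMechanism

variable {n : ℕ} {V : ℝ}

/-- The revenue guarantee: worst-case expected revenue over all feasible distributions. -/
def guarantee (M : DirectMechanism n V) (m : Fin n → ℝ) : EReal :=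
  ⨅ F ∈ feasibleDistributions V m, M.expectedRevenue F

/-- `M` solves the maxmin problem: it is dominant-strategy incentive compatible and ex post
individually rational, and has the largest revenue guarantee among all such mechanisms. -/
def IsOptimal (M : DirectMechanism n V) (m : Fin n → ℝ) : Prop :=
  (M.IsDSIC ∧ M.IsEPIR) ∧
    ∀ M' : DirectMechanism n V, M'.IsDSIC → M'.IsEPIR → M'.guarantee m ≤ M.guarantee m

/-- For two bidders, `M` is a mechanism given by the threshold functions `p i`, where `p i` is
evaluated at the value of the opponent `i.rev` of bidder `i`: bidder `i` wins above the threshold,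
loses below it, and pays the threshold exactly upon winning. Ties may be broken in any way, except
that the object is not withheld from a bidder who reaches her threshold unless it is given to the
other bidder; so it stays unsold exactly when both values are strictly below the thresholds. -/
structure IsGivenBy (M : DirectMechanism 2 V)
    (p : Fin 2 → Set.Icc (0 : ℝ) V → Set.Icc (0 : ℝ) V) : Prop where
  wins : ∀ i v, p i (v i.rev) < v i → M.x i v = 1
  loses : ∀ i v, v i < p i (v i.rev) → M.x i v = 0
  pays : ∀ i v, M.t i v = (p i (v i.rev) : ℝ) * M.x i v
  sells : ∀ v, (∃ i, p i (v i.rev) ≤ v i) → ∃ i, M.x i v = 1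

end DirectMechanism

/-- The optimal Lagrange multipliers for two bidders with high means. -/
def lamStar (V : ℝ) (m : Fin 2 → ℝ) (i : Fin 2) : ℝ :=
  (∑ j, √(V - m j)) / √(V - m i) - 1

/-- The (highest) optimal reserve prices for two bidders with high means. -/
def rStar (V : ℝ) (m : Fin 2 → ℝ) (i : Fin 2) : ℝ :=
  lamStar V m i / (1 + lamStar V m i) * V

end RobustAuction

end

/-! The proof is by duality. A guarantee of at least `g` at the mean vector `m` amounts to an affine
minorant of the revenue whose value at `m` is `g`: integrating the minorant gives the bound in one
direction, separating `(m, g)` from a convex epigraph gives it in the other (`le_guarantee`,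
`exists_affine_minorant`).

Incentives restrict such minorants. At each profile the revenue is nonpositive, or some bidder wins
and the revenue stays at most her current value however far that value is raised
(`revenue_nonpos_or_le`). Write `a` and `b` for `√(V - m 0)` and `√(V - m 1)`. Testing the minorant
at one well-chosen profile, or only at the top profile when the product of the slopes is at least
one, yields `g ≤ V - 2ab`, with equality only for the slopes `b/a` and `a/b`, which are the starred
multipliers (`value_le`). So a mechanism that guarantees `V - 2ab` has a revenue above one specific
function, `L(v) = ∑ i, lam i * (v i - r i)`.

For a threshold mechanism, `L ≤ revenue` is equivalent to the three conditions (`minorant_le`,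
`thresholdConditions`). An auction with kinked thresholds satisfies them, so the bound is attained
and optimality means exactly a guarantee of `V - 2ab`. -/

namespace RobustAuction

/-! ### Bounds on affine minorants of the revenue -/

/-- Upper bound on the value of an affine minorant with nonnegative slopes `x`, `y` and value `K` at
the top profile; `p` and `q` are the distances of the two values from the top. -/
theorem value_le_of_nonneg {V a b x y K : ℝ} (hV : 0 < V) (ha : 0 < a) (hb : 0 < b)
    (hab : (a + b) ^ 2 ≤ V) (hx : 0 ≤ x) (hy : 0 ≤ y)
    (h : ∀ p q : ℝ, 0 ≤ p → p ≤ V → 0 ≤ q → q ≤ V →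
      K ≤ x * p + y * q ∨ p - y * q ≤ V - K ∨ q - x * p ≤ V - K) :
    K - x * a ^ 2 - y * b ^ 2 ≤ V - 2 * a * b ∧
      (K - x * a ^ 2 - y * b ^ 2 = V - 2 * a * b → x * a = b ∧ y * b = a) := by
  have hx1 : 0 < 1 + x := by linarith
  have hy1 : 0 < 1 + y := by linarith
  have hK : K ≤ V := by
    rcases h 0 0 le_rfl hV.le le_rfl hV.le with h | h | h <;> linarith
  by_cases hxy : 1 ≤ x * y
  -- With `x * y ≥ 1`, the bound is `K ≤ V` together with the AM-GM inequality for `x * a ^ 2` and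
  -- `y * b ^ 2`; the identity also exposes the equality case.
  · have hsq : (2 * a * b) ^ 2 + (x * a ^ 2 - y * b ^ 2) ^ 2 + 4 * (x * y - 1) * (a * b) ^ 2
        = (x * a ^ 2 + y * b ^ 2) ^ 2 := by ring
    have hab0 : 0 < (a * b) ^ 2 := by positivity
    have h1 : 0 ≤ 4 * (x * y - 1) * (a * b) ^ 2 :=
      mul_nonneg (by linarith) hab0.le
    have h2 : 2 * a * b ≤ x * a ^ 2 + y * b ^ 2 := by
      refine le_of_sq_le_sq ?_ (by positivity)
      nlinarith [sq_nonneg (x * a ^ 2 - y * b ^ 2)]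
    refine ⟨by linarith, fun he => ?_⟩
    have h3 : x * a ^ 2 + y * b ^ 2 = 2 * a * b := by linarith
    rw [h3] at hsq
    have h4 : (x * a ^ 2 - y * b ^ 2) ^ 2 = 0 := by
      nlinarith [sq_nonneg (x * a ^ 2 - y * b ^ 2)]
    have h5 : x * a ^ 2 = y * b ^ 2 := by
      have := pow_eq_zero_iff (two_ne_zero) |>.1 h4
      linarith
    constructor
    · have : a * (x * a) = a * b := by nlinarith
      exact mul_left_cancel₀ ha.ne' this
    · have : b * (y * b) = b * a := by nlinarith
      exact mul_left_cancel₀ hb.ne' this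
  · push Not at hxy
    -- The test profile is chosen so that all three alternatives of `h` give the same upper bound on
    -- `K`.
    have hD : K ≤ V - V * (1 - x * y) / ((1 + x) * (1 + y)) := by
      have e1 : x * (V / (1 + x)) + y * (V / (1 + y))
          = V - V * (1 - x * y) / ((1 + x) * (1 + y)) := by field_simp; ring
      have e2 : V / (1 + x) - y * (V / (1 + y)) = V * (1 - x * y) / ((1 + x) * (1 + y)) := by
        field_simp; ring
      have e3 : V / (1 + y) - x * (V / (1 + x)) = V * (1 - x * y) / ((1 + x) * (1 + y)) := by
        field_simp; ring
      rcases h (V / (1 + x)) (V / (1 + y)) (by positivity)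
        (div_le_self hV.le (by linarith)) (by positivity)
        (div_le_self hV.le (by linarith)) with h | h | h <;> linarith
    have hS : (a + b) ^ 2 * (1 - x * y) / ((1 + x) * (1 + y))
        ≤ V * (1 - x * y) / ((1 + x) * (1 + y)) := by
      have : 0 ≤ 1 - x * y := by linarith
      gcongr
    -- Replacing `V` by `(a + b) ^ 2` in the bound leaves exactly `2ab` plus two squares, whose
    -- vanishing is the equality case.
    have hid : (a + b) ^ 2 * (1 - x * y) / ((1 + x) * (1 + y)) + x * a ^ 2 + y * b ^ 2
        = 2 * a * b + (x * a - b) ^ 2 / (1 + x) + (y * b - a) ^ 2 / (1 + y) := by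
      field_simp; ring
    have hp : 0 ≤ (x * a - b) ^ 2 / (1 + x) := by positivity
    have hq : 0 ≤ (y * b - a) ^ 2 / (1 + y) := by positivity
    refine ⟨by linarith, fun he => ?_⟩
    have hp0 : (x * a - b) ^ 2 / (1 + x) = 0 := by linarith
    have hq0 : (y * b - a) ^ 2 / (1 + y) = 0 := by linarith
    rw [div_eq_zero_iff, or_iff_left hx1.ne', sq_eq_zero_iff] at hp0
    rw [div_eq_zero_iff, or_iff_left hy1.ne', sq_eq_zero_iff] at hq0
    constructor <;> linarith

/-- Upper bound on the value `g` at the mean vector `(V - a², V - b²)` of an affine minorant of the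
revenue, with slopes `x` and `y` of arbitrary sign. -/
theorem value_le {V a b x y g : ℝ} (hV : 0 < V) (ha : 0 < a) (hb : 0 < b)
    (hab : (a + b) ^ 2 ≤ V) {ℓ : ℝ → ℝ → ℝ}
    (hℓ : ∀ p q, ℓ p q = g + x * (p - (V - a ^ 2)) + y * (q - (V - b ^ 2)))
    (h : ∀ p q : ℝ, 0 ≤ p → p ≤ V → 0 ≤ q → q ≤ V →
      ℓ p q ≤ 0 ∨ (∀ w, p ≤ w → w ≤ V → ℓ w q ≤ p) ∨ (∀ w, q ≤ w → w ≤ V → ℓ p w ≤ q)) :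
    g ≤ V - 2 * a * b ∧ (g = V - 2 * a * b → x * a = b ∧ y * b = a) := by
  have hma : 0 < V - a ^ 2 := by nlinarith [mul_pos ha hb, pow_pos hb 2]
  have hmb : 0 < V - b ^ 2 := by nlinarith [mul_pos ha hb, pow_pos ha 2]
  have hpos : 0 < V - 2 * a * b := by nlinarith [pow_pos ha 2, pow_pos hb 2]
  rcases le_or_gt 0 x with hx | hx <;> rcases le_or_gt 0 y with hy | hy
  · have := value_le_of_nonneg (K := g + x * a ^ 2 + y * b ^ 2) hV ha hb hab hx hy ?_
    · convert this using 2 <;> ring_nf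
    intro p q hp hpV hq hqV
    rcases h (V - p) (V - q) (by linarith) (by linarith) (by linarith) (by linarith) with h | h | h
    · left; rw [hℓ] at h; linarith
    · have := h V (by linarith) le_rfl
      rw [hℓ] at this
      right; left; linarith
    · have := h V (by linarith) le_rfl
      rw [hℓ] at this
      right; right; linarith
  -- A negative slope is replaced by zero: `K` is the value of the minorant at `(V, 0)`, and only
  -- profiles with second value `0` are tested. As the second mean is positive, this strictly raises
  -- the value at the mean, so equality is excluded.
  · have := value_le_of_nonneg (K := g + x * a ^ 2 - y * (V - b ^ 2)) hV ha hb hab hx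
      (le_refl 0) ?_
    · have hlt : 0 < -y * (V - b ^ 2) := mul_pos (by linarith) hmb
      have : g < V - 2 * a * b := by linarith [this.1]
      exact ⟨this.le, fun e => absurd e this.ne⟩
    intro p q hp hpV hq hqV
    rcases h (V - p) 0 (by linarith) (by linarith) le_rfl hV.le with h | h | h
    · left; rw [hℓ] at h; linarith
    · have := h V (by linarith) le_rfl
      rw [hℓ] at this
      right; left; linarith
    · have := h 0 le_rfl hV.le
      rw [hℓ] at this
      left; linarith
  · have := value_le_of_nonneg (K := g - x * (V - a ^ 2) + y * b ^ 2) hV ha hb hab (le_refl 0)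
      hy ?_
    · have hlt : 0 < -x * (V - a ^ 2) := mul_pos (by linarith) hma
      have : g < V - 2 * a * b := by linarith [this.1]
      exact ⟨this.le, fun e => absurd e this.ne⟩
    intro p q hp hpV hq hqV
    rcases h 0 (V - q) le_rfl hV.le (by linarith) (by linarith) with h | h | h
    · left; rw [hℓ] at h; linarith
    · have := h 0 le_rfl hV.le
      rw [hℓ] at this
      left; linarith
    · have := h V (by linarith) le_rfl
      rw [hℓ] at this
      right; right; linarith
  · have h0 : ℓ 0 0 ≤ 0 := by
      rcases h 0 0 le_rfl hV.le le_rfl hV.le with h | h | h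
      · exact h
      · exact h 0 le_rfl hV.le
      · exact h 0 le_rfl hV.le
    rw [hℓ] at h0
    have h1 : 0 < -x * (V - a ^ 2) := mul_pos (by linarith) hma
    have h2 : 0 < -y * (V - b ^ 2) := mul_pos (by linarith) hmb
    have : g < V - 2 * a * b := by linarith
    exact ⟨this.le, fun e => absurd e this.ne⟩

/-! ### Revenue under incentive compatibility and individual rationality -/

namespace DirectMechanism

variable {n : ℕ} {V : ℝ}

theorem x_nonneg (M : DirectMechanism n V) (i : Fin n) (v : Profile n V) : 0 ≤ M.x i v := by
  rcases M.x_zero_or_one i v with h | h <;> simp [h]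

theorem x_le_one (M : DirectMechanism n V) (i : Fin n) (v : Profile n V) : M.x i v ≤ 1 := by
  rcases M.x_zero_or_one i v with h | h <;> simp [h]

theorem x_eq_zero_of_ne (M : DirectMechanism n V) {i j : Fin n} {v : Profile n V}
    (hi : M.x i v = 1) (hj : j ≠ i) : M.x j v = 0 := by
  rcases M.x_zero_or_one j v with h | h
  · exact h
  · have h1 : ∑ k ∈ ({i, j} : Finset (Fin n)), M.x k v ≤ ∑ k, M.x k v :=
      Finset.sum_le_sum_of_subset_of_nonneg (Finset.subset_univ _)
        (fun k _ _ => M.x_nonneg k v)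
    rw [Finset.sum_pair hj.symm, hi, h] at h1
    linarith [M.sum_x_le_one v]

theorem IsEPIR.t_nonpos {M : DirectMechanism n V} (hM : M.IsEPIR) {i : Fin n} {v : Profile n V}
    (h : M.x i v = 0) : M.t i v ≤ 0 := by
  have := hM i v
  rw [h] at this
  linarith

theorem IsEPIR.revenue_le_of_winner {M : DirectMechanism n V} (hM : M.IsEPIR) {i : Fin n}
    {v : Profile n V} (h : M.x i v = 1) : M.revenue v ≤ M.t i v := by
  unfold revenue
  rw [← Finset.add_sum_erase _ _ (Finset.mem_univ i)]
  have : ∑ j ∈ Finset.univ.erase i, M.t j v ≤ 0 :=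
    Finset.sum_nonpos fun j hj => hM.t_nonpos (M.x_eq_zero_of_ne h (Finset.ne_of_mem_erase hj))
  linarith

theorem IsEPIR.revenue_nonpos_of_unsold {M : DirectMechanism n V} (hM : M.IsEPIR)
    {v : Profile n V} (h : ∀ i, M.x i v = 0) : M.revenue v ≤ 0 :=
  Finset.sum_nonpos fun i _ => hM.t_nonpos (h i)

theorem measurable_revenue (M : DirectMechanism n V) : Measurable M.revenue :=
  Finset.measurable_fun_sum _ fun i _ => M.measurable_t i

/-- Either the revenue is nonpositive, or the winner's bid bounds the revenue at all profiles in
which only the winner's value is raised. -/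
theorem revenue_nonpos_or_le {M : DirectMechanism n V} (hD : M.IsDSIC) (hR : M.IsEPIR)
    (v : Profile n V) :
    M.revenue v ≤ 0 ∨ ∃ i, ∀ w : Set.Icc (0 : ℝ) V, v i ≤ w →
      M.revenue (Function.update v i w) ≤ v i := by
  by_cases h : ∀ i, M.x i v = 0
  · exact Or.inl (hR.revenue_nonpos_of_unsold h)
  push Not at h
  obtain ⟨i, hi⟩ := h
  have hi1 : M.x i v = 1 := (M.x_zero_or_one i v).resolve_left hi
  have htv : M.t i v ≤ v i := by have := hR i v; rw [hi1] at this; linarith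
  refine Or.inr ⟨i, fun w hw => ?_⟩
  rcases hw.eq_or_lt with rfl | hlt
  · rw [Function.update_eq_self]
    exact (hR.revenue_le_of_winner hi1).trans htv
  have hlt' : (v i : ℝ) < w := hlt
  -- The two incentive constraints between `v i` and `w`: losing at the higher report would force `w
  -- ≤ v i`, and winning there costs no more than `t i v`.
  have h1 := hD i v w
  have h2 := hD i (Function.update v i w) (v i)
  rw [Function.update_idem, Function.update_eq_self, Function.update_self, hi1] at h2
  rw [hi1] at h1
  rcases M.x_zero_or_one i (Function.update v i w) with h0 | h0
  · rw [h0] at h1 h2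
    linarith
  · rw [h0] at h2
    exact (hR.revenue_le_of_winner h0).trans (by linarith)

theorem IsEPIR.revenue_le {M : DirectMechanism n V} (hR : M.IsEPIR) (hV : 0 ≤ V)
    (v : Profile n V) : M.revenue v ≤ V := by
  by_cases h : ∀ i, M.x i v = 0
  · exact (hR.revenue_nonpos_of_unsold h).trans hV
  push Not at h
  obtain ⟨i, hi⟩ := h
  have hi1 : M.x i v = 1 := (M.x_zero_or_one i v).resolve_left hi
  have := hR i v
  rw [hi1] at this
  linarith [hR.revenue_le_of_winner hi1, (v i).2.2]

/-! ### Duality between guarantees and affine minorants -/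

theorem expectedRevenue_eq_integral (M : DirectMechanism n V) {F : Measure (Profile n V)}
    (h : Integrable M.revenue F) : M.expectedRevenue F = ((∫ v, M.revenue v ∂F : ℝ) : EReal) := by
  rw [integral_eq_lintegral_pos_part_sub_lintegral_neg_part h, EReal.coe_sub]
  unfold expectedRevenue
  have h1 : ∫⁻ v, ENNReal.ofReal (M.revenue v) ∂F ≠ ⊤ := h.lintegral_lt_top.ne
  have h2 : ∫⁻ v, ENNReal.ofReal (-M.revenue v) ∂F ≠ ⊤ := h.neg.lintegral_lt_top.ne
  lift ∫⁻ v, ENNReal.ofReal (M.revenue v) ∂F to NNReal using h1 with a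
  lift ∫⁻ v, ENNReal.ofReal (-M.revenue v) ∂F to NNReal using h2 with b
  rfl

theorem integrable_coord {F : Measure (Profile n V)} [IsFiniteMeasure F] (i : Fin n) :
    Integrable (fun v : Profile n V => (v i : ℝ)) F := by
  refine Integrable.of_bound (C := V)
    (measurable_subtype_coe.comp (measurable_pi_apply i)).aestronglyMeasurable
    (Filter.Eventually.of_forall fun v => ?_)
  rw [Real.norm_of_nonneg (v i).2.1]
  exact (v i).2.2

/-- An affine minorant of a bounded revenue function bounds the guarantee from below. -/
theorem le_guarantee (M : DirectMechanism n V) {m lam : Fin n → ℝ} {g B : ℝ}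
    (hB : ∀ v, |M.revenue v| ≤ B)
    (h : ∀ v : Profile n V, g + ∑ i, lam i * ((v i : ℝ) - m i) ≤ M.revenue v) :
    (g : EReal) ≤ M.guarantee m := by
  refine le_iInf₂ fun F hF => ?_
  obtain ⟨hP, hF⟩ := hF
  have hint : Integrable M.revenue F :=
    Integrable.of_bound M.measurable_revenue.aestronglyMeasurable B
      (Filter.Eventually.of_forall hB)
  rw [M.expectedRevenue_eq_integral hint, EReal.coe_le_coe_iff]
  have hi : ∀ i, Integrable (fun v : Profile n V => lam i * ((v i : ℝ) - m i)) F := fun i =>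
    ((integrable_coord i).sub (integrable_const _)).const_mul _
  have hs : Integrable (fun v : Profile n V => ∑ i, lam i * ((v i : ℝ) - m i)) F :=
    integrable_finsetSum _ fun i _ => hi i
  have := integral_mono ((integrable_const g).add hs) hint h
  simp only [Pi.add_apply] at this
  rw [integral_add (integrable_const g) hs, integral_finsetSum _ fun i _ => hi i] at this
  have hz : ∀ i, ∫ v : Profile n V, lam i * ((v i : ℝ) - m i) ∂F = 0 := fun i => by
    rw [integral_const_mul, integral_sub (integrable_coord i) (integrable_const _), hF i]
    simp
  simpa [hz] using this

/-- The pairs of a mean vector and a strict upper bound on the expected revenue of some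
distribution with these means. -/
def revenueEpigraph (M : DirectMechanism n V) : Set ((Fin n → ℝ) × ℝ) :=
  {q | ∃ F ∈ feasibleDistributions V q.1, Integrable M.revenue F ∧ ∫ v, M.revenue v ∂F < q.2}

theorem convex_revenueEpigraph (M : DirectMechanism n V) : Convex ℝ M.revenueEpigraph := by
  rintro q ⟨F, ⟨hF, hFm⟩, hFi, hFr⟩ q' ⟨G, ⟨hG, hGm⟩, hGi, hGr⟩ a b ha hb hab
  refine ⟨ENNReal.ofReal a • F + ENNReal.ofReal b • G, ⟨⟨?_⟩, fun i => ?_⟩, ?_, ?_⟩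
  · simp [← ENNReal.ofReal_add ha hb, hab]
  · rw [integral_add_measure ((integrable_coord i).smul_measure ENNReal.ofReal_ne_top)
      ((integrable_coord i).smul_measure ENNReal.ofReal_ne_top), integral_smul_measure,
      integral_smul_measure, hFm, hGm, ENNReal.toReal_ofReal ha, ENNReal.toReal_ofReal hb]
    rfl
  · exact (hFi.smul_measure ENNReal.ofReal_ne_top).add_measure
      (hGi.smul_measure ENNReal.ofReal_ne_top)
  · rw [integral_add_measure (hFi.smul_measure ENNReal.ofReal_ne_top)
      (hGi.smul_measure ENNReal.ofReal_ne_top), integral_smul_measure,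
      integral_smul_measure, ENNReal.toReal_ofReal ha, ENNReal.toReal_ofReal hb]
    simp only [smul_eq_mul, Prod.snd_add, Prod.smul_snd]
    rcases ha.eq_or_lt with rfl | ha'
    · have : b = 1 := by linarith
      subst this
      linarith
    · have := mul_lt_mul_of_pos_left hFr ha'
      have := mul_le_mul_of_nonneg_left hGr.le hb
      linarith

theorem mem_revenueEpigraph_dirac (M : DirectMechanism n V) (v : Profile n V) {s : ℝ}
    (hs : M.revenue v < s) : ((fun i => (v i : ℝ)), s) ∈ M.revenueEpigraph := by
  refine ⟨Measure.dirac v, ⟨inferInstance, fun i => ?_⟩, ?_, ?_⟩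
  · rw [integral_dirac]
  · exact integrable_dirac (by simp)
  · rwa [integral_dirac]

/-- A lower bound on the guarantee is attained by an affine minorant of the revenue. -/
theorem exists_affine_minorant (M : DirectMechanism n V) {m : Fin n → ℝ} {g B : ℝ}
    (hm : ∀ i, 0 < m i ∧ m i < V) (hB : ∀ v, M.revenue v ≤ B) (hgB : g ≤ B)
    (hg : (g : EReal) ≤ M.guarantee m) :
    ∃ lam : Fin n → ℝ, ∀ v : Profile n V,
      g + ∑ i, lam i * ((v i : ℝ) - m i) ≤ M.revenue v := by
  have hnot : (m, g) ∉ interior M.revenueEpigraph := fun hmem => by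
    obtain ⟨F, hF, hFi, hFr⟩ := interior_subset hmem
    have h1 : M.guarantee m ≤ M.expectedRevenue F := iInf₂_le F hF
    rw [M.expectedRevenue_eq_integral hFi] at h1
    exact absurd (EReal.coe_le_coe_iff.1 (hg.trans h1)) (not_le.2 hFr)
  -- Dirac measures put every mean vector in the open cube, with every level above `B`, into the
  -- epigraph.
  have hint : (m, B + 1) ∈ interior M.revenueEpigraph := by
    refine mem_interior.2 ⟨(Set.univ.pi fun _ => Set.Ioo 0 V) ×ˢ Set.Ioi B, ?_, ?_, ?_⟩
    · rintro ⟨x, s⟩ ⟨hx, hs⟩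
      have hx' : ∀ i, x i ∈ Set.Ioo 0 V := fun i => hx i trivial
      exact M.mem_revenueEpigraph_dirac (fun i => ⟨x i, (hx' i).1.le, (hx' i).2.le⟩)
        ((hB _).trans_lt hs)
    · exact (isOpen_set_pi Set.finite_univ fun _ _ => isOpen_Ioo).prod isOpen_Ioi
    · exact ⟨fun i _ => hm i, by simp⟩
  obtain ⟨f, hf⟩ := geometric_hahn_banach_open_point M.convex_revenueEpigraph.interior
    isOpen_interior hnot
  have hf' : ∀ q ∈ M.revenueEpigraph, f q ≤ f (m, g) := by
    intro q hq
    have hq' : q ∈ closure (interior M.revenueEpigraph) := by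
      rw [M.convex_revenueEpigraph.closure_interior_eq_closure_of_nonempty_interior ⟨_, hint⟩]
      exact subset_closure hq
    exact closure_minimal (fun a ha => (hf a ha).le)
      (isClosed_le f.continuous continuous_const) hq'
  have hsplit : ∀ (x : Fin n → ℝ) (s : ℝ),
      f (x, s) = ∑ i, x i * f (Pi.single i 1, 0) + s * f (0, 1) := by
    intro x s
    have h1 : (x, s) = (x, (0 : ℝ)) + s • ((0 : Fin n → ℝ), (1 : ℝ)) := by simp
    have h2 := LinearMap.pi_apply_eq_sum_univ
      (f.toLinearMap.comp (LinearMap.inl ℝ (Fin n → ℝ) ℝ)) x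
    rw [h1, map_add, map_smul]
    simp only [LinearMap.comp_apply, LinearMap.inl_apply, ContinuousLinearMap.coe_coe,
      smul_eq_mul] at h2
    rw [h2, smul_eq_mul]
    congr 1
    refine Finset.sum_congr rfl fun i _ => ?_
    congr 3
    ext j
    simp [Pi.single_apply, eq_comm]
  -- The separating hyperplane is not vertical, because `(m, B + 1)` is an interior point directly
  -- above `(m, g)`.
  have hβ : 0 < -f (0, 1) := by
    have := hf _ hint
    rw [hsplit m (B + 1), hsplit m g] at this
    by_contra! hneg
    nlinarith
  refine ⟨fun i => f (Pi.single i 1, 0) / -f (0, 1), fun v => ?_⟩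
  -- The epigraph is strict, so the Dirac measure at `v` is used at all levels `s` above the
  -- revenue.
  refine le_of_forall_gt_imp_ge_of_dense fun s hs => ?_
  have := hf' _ (M.mem_revenueEpigraph_dirac v hs)
  rw [hsplit _ s, hsplit m g] at this
  have hsum : ∑ i, f (Pi.single i 1, 0) / -f (0, 1) * ((v i : ℝ) - m i)
      = (∑ i, (v i : ℝ) * f (Pi.single i 1, 0) - ∑ i, m i * f (Pi.single i 1, 0))
        / -f (0, 1) := by
    rw [← Finset.sum_sub_distrib, Finset.sum_div]
    exact Finset.sum_congr rfl fun i _ => by ring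
  rw [hsum, ← le_sub_iff_add_le', div_le_iff₀ hβ]
  linarith

end DirectMechanism
end RobustAuction

/-! ### Two-bidder threshold mechanisms and the three conditions -/

namespace RobustAuction

theorem rev_ne_self (i : Fin 2) : i.rev ≠ i := by fin_cases i <;> decide

theorem eq_rev_of_ne {i j : Fin 2} (h : j ≠ i) : j = i.rev := by
  revert h; fin_cases i <;> fin_cases j <;> simp

theorem sum_eq_add_rev (f : Fin 2 → ℝ) (i : Fin 2) : ∑ j, f j = f i + f i.rev := by
  fin_cases i <;> simp [Fin.sum_univ_two, add_comm]

namespace DirectMechanism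

variable {V : ℝ} {M : DirectMechanism 2 V} {p : Fin 2 → Set.Icc (0 : ℝ) V → Set.Icc (0 : ℝ) V}

theorem IsGivenBy.isDSIC (h : M.IsGivenBy p) : M.IsDSIC := by
  intro i v w
  rw [h.pays, h.pays, Function.update_of_ne (rev_ne_self i)]
  rcases lt_trichotomy (v i) (p i (v i.rev)) with hlt | heq | hgt
  · rw [h.loses i v hlt]
    have : (v i : ℝ) < p i (v i.rev) := hlt
    nlinarith [M.x_nonneg i (Function.update v i w)]
  · rw [← heq]; simp
  · rw [h.wins i v hgt]
    have : (p i (v i.rev) : ℝ) < v i := hgt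
    nlinarith [M.x_le_one i (Function.update v i w)]

theorem IsGivenBy.isEPIR (h : M.IsGivenBy p) : M.IsEPIR := by
  intro i v
  rw [h.pays]
  rcases lt_or_ge (v i) (p i (v i.rev)) with hlt | hge
  · rw [h.loses i v hlt]; simp
  · have : (p i (v i.rev) : ℝ) ≤ v i := hge
    nlinarith [M.x_nonneg i v]

theorem IsGivenBy.revenue_of_winner (h : M.IsGivenBy p) {i : Fin 2} {v : Profile 2 V}
    (hi : M.x i v = 1) : M.revenue v = p i (v i.rev) := by
  unfold revenue
  rw [sum_eq_add_rev _ i, h.pays, h.pays, hi, M.x_eq_zero_of_ne hi (rev_ne_self i)]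
  simp

theorem IsGivenBy.revenue_of_unsold (h : M.IsGivenBy p) {v : Profile 2 V}
    (hi : ∀ i, M.x i v = 0) : M.revenue v = 0 := by
  unfold revenue
  simp [h.pays, hi]

theorem IsGivenBy.abs_revenue_le (h : M.IsGivenBy p) (hV : 0 ≤ V) (v : Profile 2 V) :
    |M.revenue v| ≤ V := by
  rw [abs_of_nonneg]
  · exact h.isEPIR.revenue_le hV v
  · refine Finset.sum_nonneg fun i _ => ?_
    rw [h.pays]
    exact mul_nonneg (p i (v i.rev)).2.1 (M.x_nonneg i v)

end DirectMechanism

/-- The three conditions on threshold functions `p`, for multipliers `lam` and reserve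
prices `r`. -/
structure ThresholdConditions (V : ℝ) (lam r : Fin 2 → ℝ)
    (p : Fin 2 → Set.Icc (0 : ℝ) V → Set.Icc (0 : ℝ) V) : Prop where
  eq_line : ∀ (i : Fin 2) (w : Set.Icc (0 : ℝ) V), r i.rev ≤ (w : ℝ) →
    (p i w : ℝ) = r i + lam i.rev * ((w : ℝ) - r i.rev)
  line_le : ∀ (i : Fin 2) (w : Set.Icc (0 : ℝ) V),
    r i + lam i.rev * ((w : ℝ) - r i.rev) ≤ (p i w : ℝ)
  le_cap : ∀ (i : Fin 2) (w : Set.Icc (0 : ℝ) V), (w : ℝ) ≤ r i.rev →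
    (p i w : ℝ) ≤ (lam 0 * r 0 + lam 1 * r 1 - lam i.rev * (w : ℝ)) / lam i

/-- Reserve prices and multipliers in the relations satisfied by the optimal ones. -/
structure IsBalanced (V : ℝ) (lam r : Fin 2 → ℝ) : Prop where
  r_pos : ∀ i, 0 < r i
  r_add : r 0 + r 1 = V
  lam_mul : ∀ i, lam i * r i.rev = r i

namespace IsBalanced

variable {V : ℝ} {lam r : Fin 2 → ℝ}

theorem lam_pos (h : IsBalanced V lam r) (i : Fin 2) : 0 < lam i := by
  have h1 := h.lam_mul i
  have h2 := h.r_pos i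
  rw [← h1] at h2
  exact pos_of_mul_pos_left h2 (h.r_pos _).le

theorem r_add_rev (h : IsBalanced V lam r) (i : Fin 2) : r i + r i.rev = V := by
  rw [← sum_eq_add_rev r i, Fin.sum_univ_two, h.r_add]

theorem lam_mul_lam_rev (h : IsBalanced V lam r) (i : Fin 2) : lam i * lam i.rev = 1 := by
  have h1 := h.lam_mul i
  have h2 := h.lam_mul i.rev
  rw [Fin.rev_rev] at h2
  rw [← h2, ← mul_assoc] at h1
  exact mul_right_cancel₀ (h.r_pos i).ne' (by rw [h1, one_mul])

theorem lam_mul_sub (h : IsBalanced V lam r) (i : Fin 2) : lam i * (V - r i) = r i := by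
  rw [← h.lam_mul i, ← h.r_add_rev i, h.lam_mul i]
  ring_nf
  rw [h.lam_mul i]

end IsBalanced

/-- Membership of an amount below the cap, as the sign of the affine minorant. -/
theorem le_cap_iff {V : ℝ} {lam r : Fin 2 → ℝ} (hb : IsBalanced V lam r) (i : Fin 2) (a w : ℝ) :
    a ≤ (lam 0 * r 0 + lam 1 * r 1 - lam i.rev * w) / lam i ↔
      lam i * (a - r i) + lam i.rev * (w - r i.rev) ≤ 0 := by
  have : lam 0 * r 0 + lam 1 * r 1 = lam i * r i + lam i.rev * r i.rev := by
    rw [← sum_eq_add_rev (fun j => lam j * r j) i, Fin.sum_univ_two]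
  rw [le_div_iff₀ (hb.lam_pos i), this]
  constructor <;> intro h <;> linarith

namespace DirectMechanism

variable {V : ℝ} {M : DirectMechanism 2 V} {p : Fin 2 → Set.Icc (0 : ℝ) V → Set.Icc (0 : ℝ) V}
  {lam r : Fin 2 → ℝ}

/-- If `i` wins, `L` is largest when `v i = V`, where it equals the line of condition 2, a lower
bound for the payment. If the object is unsold and some value is at most its reserve, condition 3
gives `L ≤ 0`. If both values exceed their reserves, condition 1 makes the thresholds inverse to
each other (`lam 0 * lam 1 = 1`), so the object cannot be unsold. -/
theorem IsGivenBy.minorant_le (h : M.IsGivenBy p) (hb : IsBalanced V lam r)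
    (hc : ThresholdConditions V lam r p) (v : Profile 2 V) :
    ∑ i, lam i * ((v i : ℝ) - r i) ≤ M.revenue v := by
  by_cases hs : ∃ i, M.x i v = 1
  · obtain ⟨i, hi⟩ := hs
    rw [h.revenue_of_winner hi, sum_eq_add_rev _ i]
    have h1 := hc.line_le i (v i.rev)
    have h2 := hb.lam_mul_sub i
    have h3 : lam i * ((v i : ℝ) - r i) ≤ lam i * (V - r i) :=
      mul_le_mul_of_nonneg_left (by linarith [(v i).2.2]) (hb.lam_pos i).le
    linarith
  have hx : ∀ i, M.x i v = 0 := fun i =>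
    (M.x_zero_or_one i v).resolve_right fun h1 => hs ⟨i, h1⟩
  have hlt : ∀ i, (v i : ℝ) < p i (v i.rev) := fun i => by
    by_contra hge
    exact hs (h.sells v ⟨i, not_lt.1 hge⟩)
  rw [h.revenue_of_unsold hx]
  have low : ∀ i : Fin 2, (v i.rev : ℝ) ≤ r i.rev →
      ∑ i, lam i * ((v i : ℝ) - r i) ≤ 0 := fun i hi => by
    rw [sum_eq_add_rev _ i]
    exact (le_cap_iff hb i _ _).1 ((hlt i).le.trans (hc.le_cap i _ hi))
  rcases le_or_gt (v 1 : ℝ) (r 1) with h1 | h1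
  · exact low 0 h1
  rcases le_or_gt (v 0 : ℝ) (r 0) with h0 | h0
  · exact low 1 h0
  have e0 := hc.eq_line 0 (v 1) h1.le
  have e1 := hc.eq_line 1 (v 0) h0.le
  have l0 : (v 0 : ℝ) < p 0 (v 1) := hlt 0
  have l1 : (v 1 : ℝ) < p 1 (v 0) := hlt 1
  change _ = r 0 + lam 1 * ((v 1 : ℝ) - r 1) at e0
  change _ = r 1 + lam 0 * ((v 0 : ℝ) - r 0) at e1
  have hl : lam 0 * lam 1 = 1 := hb.lam_mul_lam_rev 0
  have h2 : lam 0 * ((v 0 : ℝ) - r 0) < lam 0 * (lam 1 * ((v 1 : ℝ) - r 1)) :=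
    mul_lt_mul_of_pos_left (by linarith) (hb.lam_pos 0)
  rw [← mul_assoc, hl] at h2
  linarith

theorem IsGivenBy.revenue_eq_zero_of_lt (h : M.IsGivenBy p) {v : Profile 2 V} (i : Fin 2)
    (h1 : v i < p i (v i.rev)) (h2 : v i.rev < p i.rev (v i)) : M.revenue v = 0 := by
  refine h.revenue_of_unsold fun j => ?_
  by_cases hj : j = i
  · subst hj
    exact h.loses _ v h1
  · obtain rfl := eq_rev_of_ne hj
    exact h.loses _ v (by rwa [Fin.rev_rev])

/-- Condition 2 is the minorant inequality at `v i = V`. If condition 1 or 3 failed, there would be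
room between the prescribed bound and the threshold for a value at which the object is unsold
although `L > 0`. -/
theorem IsGivenBy.thresholdConditions (h : M.IsGivenBy p) (hb : IsBalanced V lam r) (hV : 0 ≤ V)
    (hM : ∀ v : Profile 2 V, ∑ i, lam i * ((v i : ℝ) - r i) ≤ M.revenue v) :
    ThresholdConditions V lam r p := by
  have hM' : ∀ (i : Fin 2) (a w : Set.Icc (0 : ℝ) V), lam i * ((a : ℝ) - r i)
      + lam i.rev * ((w : ℝ) - r i.rev) ≤ M.revenue (Function.update (fun _ => w) i a) := by
    intro i a w
    have := hM (Function.update (fun _ => w) i a)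
    rwa [sum_eq_add_rev _ i, Function.update_self, Function.update_of_ne (rev_ne_self i)] at this
  have hline : ∀ (i : Fin 2) (w : Set.Icc (0 : ℝ) V),
      r i + lam i.rev * ((w : ℝ) - r i.rev) ≤ (p i w : ℝ) := by
    intro i w
    have h1 := hM' i ⟨V, hV, le_rfl⟩ w
    set v : Profile 2 V := Function.update (fun _ => w) i ⟨V, hV, le_rfl⟩ with hv
    have hvi : (v i : ℝ) = V := by rw [hv, Function.update_self]
    have hvr : v i.rev = w := by rw [hv, Function.update_of_ne (rev_ne_self i)]
    rcases M.x_zero_or_one i v with hx | hx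
    -- If `i` does not win with value `V`, her threshold is `V`, and the line never exceeds `V`.
    · have h2 : (v i : ℝ) ≤ p i (v i.rev) := by
        by_contra! hlt
        have := h.wins i v hlt
        rw [hx] at this
        norm_num at this
      rw [hvi, hvr] at h2
      have h3 := hb.lam_mul_sub i.rev
      have h4 : lam i.rev * ((w : ℝ) - r i.rev) ≤ lam i.rev * (V - r i.rev) :=
        mul_le_mul_of_nonneg_left (by linarith [w.2.2]) (hb.lam_pos _).le
      linarith [hb.r_add_rev i]
    · rw [h.revenue_of_winner hx, hvr] at h1
      have := hb.lam_mul_sub i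
      simp only at h1
      linarith
  have hunsold : ∀ (i : Fin 2) (a w : Set.Icc (0 : ℝ) V), a < p i w →
      (w : ℝ) < r i.rev + lam i * ((a : ℝ) - r i) →
      lam i * ((a : ℝ) - r i) + lam i.rev * ((w : ℝ) - r i.rev) ≤ 0 := by
    intro i a w ha hw
    refine (hM' i a w).trans_eq (h.revenue_eq_zero_of_lt i ?_ ?_)
    · rwa [Function.update_self, Function.update_of_ne (rev_ne_self i)]
    · rw [Function.update_self, Function.update_of_ne (rev_ne_self i)]
      have := hline i.rev a
      rw [Fin.rev_rev] at this
      exact hw.trans_le this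
  refine ⟨fun i w hw => le_antisymm ?_ (hline i w), hline, fun i w hw => ?_⟩
  · by_contra! hlt
    -- At the value `a`, bidder `i` is below her threshold; since the two lines are inverse to each
    -- other, the opponent's value `w` is below the line at `a`, hence below hers.
    obtain ⟨a, ha1, ha2⟩ := exists_between hlt
    have hpos : 0 ≤ lam i.rev * ((w : ℝ) - r i.rev) :=
      mul_nonneg (hb.lam_pos _).le (by linarith)
    have h1 : lam i * (lam i.rev * ((w : ℝ) - r i.rev)) < lam i * (a - r i) :=
      mul_lt_mul_of_pos_left (by linarith) (hb.lam_pos i)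
    have h2 := h1
    rw [← mul_assoc, hb.lam_mul_lam_rev] at h2
    have := hunsold i ⟨a, by linarith [hb.r_pos i], by linarith [(p i w).2.2]⟩ w ha2
      (by simp only; linarith)
    simp only at this
    linarith
  · rw [le_cap_iff hb]
    by_contra! hlt
    have hneg : lam i.rev * ((w : ℝ) - r i.rev) ≤ 0 :=
      mul_nonpos_of_nonneg_of_nonpos (hb.lam_pos _).le (by linarith)
    -- The left side is the zero of `L` in the value of `i`. Any larger `a` has `L > 0`, hence `a >
    -- r i`, so that `w ≤ r i.rev` lies strictly below the opponent's line.
    have hq : r i - lam i.rev * ((w : ℝ) - r i.rev) / lam i < p i w := by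
      rw [sub_lt_iff_lt_add, ← sub_lt_iff_lt_add', lt_div_iff₀ (hb.lam_pos i)]
      linarith
    obtain ⟨a, ha1, ha2⟩ := exists_between hq
    have ha3 : 0 < lam i * (a - r i) + lam i.rev * ((w : ℝ) - r i.rev) := by
      rw [sub_lt_iff_lt_add, ← sub_lt_iff_lt_add', lt_div_iff₀ (hb.lam_pos i)] at ha1
      linarith
    have ha4 : 0 < a - r i := pos_of_mul_pos_right (by linarith) (hb.lam_pos i).le
    have := hunsold i ⟨a, by linarith [hb.r_pos i], by linarith [(p i w).2.2]⟩ w ha2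
      (by simp only; linarith)
    simp only at this
    linarith

end DirectMechanism

/-! ### An auction attaining the bound -/

/-- The threshold that equals the reserve price `r i` as long as the opponent does not exceed
hers, and is affine above. -/
def kinkedThreshold {V : ℝ} {lam r : Fin 2 → ℝ} (hb : IsBalanced V lam r) (i : Fin 2)
    (w : Set.Icc (0 : ℝ) V) : Set.Icc (0 : ℝ) V :=
  ⟨r i + lam i.rev * max 0 ((w : ℝ) - r i.rev),
    add_nonneg (hb.r_pos i).le (mul_nonneg (hb.lam_pos _).le (le_max_left _ _)), by
      have h1 := hb.lam_mul_sub i.rev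
      have h2 := hb.r_add_rev i
      have h3 : max 0 ((w : ℝ) - r i.rev) ≤ V - r i.rev :=
        max_le (by linarith [hb.r_pos i]) (by linarith [w.2.2])
      have := mul_le_mul_of_nonneg_left h3 (hb.lam_pos i.rev).le
      linarith⟩

section kinked

variable {V : ℝ} {lam r : Fin 2 → ℝ} (hb : IsBalanced V lam r)

theorem thresholdConditions_kinkedThreshold :
    ThresholdConditions V lam r (kinkedThreshold hb) := by
  refine ⟨fun i w hw => ?_, fun i w => ?_, fun i w hw => ?_⟩
  · simp only [kinkedThreshold]
    rw [max_eq_right (by linarith)]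
  · simp only [kinkedThreshold]
    have := mul_le_mul_of_nonneg_left (le_max_right 0 ((w : ℝ) - r i.rev)) (hb.lam_pos i.rev).le
    linarith
  · rw [le_cap_iff hb]
    simp only [kinkedThreshold]
    rw [max_eq_left (by linarith)]
    have : lam i.rev * ((w : ℝ) - r i.rev) ≤ 0 :=
      mul_nonpos_of_nonneg_of_nonpos (hb.lam_pos _).le (by linarith)
    linarith

/-- This makes the tie-breaking in favour of the first bidder harmless: it never takes the object
from a second bidder strictly above her threshold. -/
theorem lt_kinkedThreshold_of_lt {a b : Set.Icc (0 : ℝ) V} (h : kinkedThreshold hb 1 a < b) :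
    a < kinkedThreshold hb 0 b := by
  have h' : r 1 + lam 0 * max 0 ((a : ℝ) - r 0) < b := h
  change (a : ℝ) < r 0 + lam 1 * max 0 ((b : ℝ) - r 1)
  have h0 : lam 0 * lam 1 = 1 := hb.lam_mul_lam_rev 0
  have h1 : 0 ≤ lam 0 * max 0 ((a : ℝ) - r 0) := mul_nonneg (hb.lam_pos 0).le (le_max_left _ _)
  have h2 : lam 1 * (lam 0 * max 0 ((a : ℝ) - r 0)) < lam 1 * ((b : ℝ) - r 1) :=
    mul_lt_mul_of_pos_left (by linarith) (hb.lam_pos 1)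
  rw [← mul_assoc, mul_comm (lam 1), h0, one_mul] at h2
  rw [max_eq_right (by linarith)]
  linarith [le_max_right 0 ((a : ℝ) - r 0)]

theorem measurable_kinkedThreshold (i : Fin 2) : Measurable (kinkedThreshold hb i) := by
  refine Measurable.subtype_mk ?_
  fun_prop

/-- The winning region of each bidder in the auction with kinked thresholds; ties go to the first
bidder. -/
def kinkedWin (i : Fin 2) : Set (Profile 2 V) :=
  if i = 0 then {v | kinkedThreshold hb 0 (v 1) ≤ v 0}
  else {v | kinkedThreshold hb 1 (v 0) ≤ v 1} \ {v | kinkedThreshold hb 0 (v 1) ≤ v 0}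

theorem measurableSet_kinkedWin (i : Fin 2) : MeasurableSet (kinkedWin hb i) := by
  have h0 : MeasurableSet {v : Profile 2 V | kinkedThreshold hb 0 (v 1) ≤ v 0} :=
    measurableSet_le ((measurable_kinkedThreshold hb 0).comp (measurable_pi_apply 1))
      (measurable_pi_apply 0)
  have h1 : MeasurableSet {v : Profile 2 V | kinkedThreshold hb 1 (v 0) ≤ v 1} :=
    measurableSet_le ((measurable_kinkedThreshold hb 1).comp (measurable_pi_apply 0))
      (measurable_pi_apply 1)
  unfold kinkedWin
  split_ifs
  · exact h0
  · exact h1.diff h0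

/-- The auction with kinked thresholds. -/
noncomputable def kinkedAuction : DirectMechanism 2 V where
  x i := (kinkedWin hb i).indicator 1
  t i v := kinkedThreshold hb i (v i.rev) * (kinkedWin hb i).indicator 1 v
  measurable_x i := measurable_one.indicator (measurableSet_kinkedWin hb i)
  measurable_t i := by
    have h1 : Measurable fun v : Profile 2 V => (kinkedThreshold hb i (v i.rev) : ℝ) :=
      measurable_subtype_coe.comp
        ((measurable_kinkedThreshold hb i).comp (measurable_pi_apply i.rev))
    exact h1.mul (measurable_one.indicator (measurableSet_kinkedWin hb i))
  x_zero_or_one i v := by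
    by_cases h : v ∈ kinkedWin hb i <;> simp [h]
  sum_x_le_one v := by
    rw [Fin.sum_univ_two]
    by_cases h : v ∈ kinkedWin hb 0
    · have h1 : v ∉ kinkedWin hb 1 := fun h1 => h1.2 h
      simp [h, h1]
    · by_cases h1 : v ∈ kinkedWin hb 1 <;> simp [h, h1]

theorem kinkedAuction_isGivenBy : (kinkedAuction hb).IsGivenBy (kinkedThreshold hb) where
  wins i v h := by
    refine Set.indicator_of_mem ?_ _
    match i with
    | 0 => exact h.le
    | 1 => exact ⟨h.le, not_le.2 (lt_kinkedThreshold_of_lt hb h)⟩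
  loses i v h := by
    refine Set.indicator_of_notMem ?_ _
    match i with
    | 0 => exact not_le.2 h
    | 1 => exact fun h1 => not_le.2 h h1.1
  pays i v := rfl
  sells v h := by
    by_cases h0 : v ∈ kinkedWin hb 0
    · exact ⟨0, Set.indicator_of_mem h0 _⟩
    · obtain ⟨i, hi⟩ := h
      match i with
      | 0 => exact absurd hi h0
      | 1 =>
        have h1 : v ∈ kinkedWin hb 1 := ⟨hi, h0⟩
        exact ⟨1, Set.indicator_of_mem h1 _⟩

end kinked

end RobustAuction

/-! ### The starred multipliers and optimality -/

namespace RobustAuction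

section star

variable {V : ℝ} {m : Fin 2 → ℝ}

theorem lamStar_eq (hm : ∀ i, m i < V) (i : Fin 2) :
    lamStar V m i = √(V - m i.rev) / √(V - m i) := by
  have h : √(V - m i) ≠ 0 := (Real.sqrt_pos.2 (by linarith [hm i])).ne'
  unfold lamStar
  rw [sum_eq_add_rev _ i]
  field_simp
  ring

theorem rStar_eq (hm : ∀ i, m i < V) (i : Fin 2) :
    rStar V m i = √(V - m i.rev) / (√(V - m 0) + √(V - m 1)) * V := by
  have h : 0 < √(V - m i) := Real.sqrt_pos.2 (by linarith [hm i])
  have h' : 0 < √(V - m i.rev) := Real.sqrt_pos.2 (by linarith [hm i.rev])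
  unfold rStar
  rw [lamStar_eq hm, ← Fin.sum_univ_two (fun j => √(V - m j)), sum_eq_add_rev _ i]
  field_simp

theorem isBalanced_star (hm : ∀ i, 0 < m i ∧ m i < V) :
    IsBalanced V (lamStar V m) (rStar V m) := by
  have hV : 0 < V := (hm 0).1.trans (hm 0).2
  have hm' : ∀ i, m i < V := fun i => (hm i).2
  have h : ∀ i, 0 < √(V - m i) := fun i => Real.sqrt_pos.2 (by linarith [hm' i])
  have h0 := h 0
  have h1 := h 1
  refine ⟨fun i => ?_, ?_, fun i => ?_⟩
  · rw [rStar_eq hm']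
    have := h i.rev
    positivity
  · rw [rStar_eq hm', rStar_eq hm']
    change √(V - m 1) / _ * V + √(V - m 0) / _ * V = V
    field_simp
    ring
  · rw [rStar_eq hm', rStar_eq hm', lamStar_eq hm', Fin.rev_rev]
    have := h i
    field_simp

/-- The value of `L` at the mean vector equals the upper bound of `value_le`; this identifies `L`
with the extremal minorant. -/
theorem sum_lamStar_mul (hm : ∀ i, 0 < m i ∧ m i < V) :
    ∑ i, lamStar V m i * (m i - rStar V m i) = V - 2 * √(V - m 0) * √(V - m 1) := by
  have hm' : ∀ i, m i < V := fun i => (hm i).2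
  have h : ∀ i, 0 < √(V - m i) := fun i => Real.sqrt_pos.2 (by linarith [hm' i])
  have hs : ∀ i, m i = V - √(V - m i) ^ 2 := fun i => by
    rw [Real.sq_sqrt (by linarith [hm' i])]; ring
  have h0 := h 0
  have h1 := h 1
  rw [Fin.sum_univ_two, rStar_eq hm', rStar_eq hm', lamStar_eq hm', lamStar_eq hm']
  change √(V - m 1) / √(V - m 0) * (m 0 - √(V - m 1) / _ * V)
    + √(V - m 0) / √(V - m 1) * (m 1 - √(V - m 0) / _ * V) = _
  have e0 := hs 0
  have e1 := hs 1
  generalize √(V - m 0) = a at *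
  generalize √(V - m 1) = b at *
  rw [e0, e1]
  field_simp
  ring

theorem sq_add_le (hm : ∀ i, 0 < m i ∧ m i < V)
    (hhigh : √(1 - m 0 / V) + √(1 - m 1 / V) ≤ 1) :
    (√(V - m 0) + √(V - m 1)) ^ 2 ≤ V := by
  have hV : 0 < V := (hm 0).1.trans (hm 0).2
  have h : ∀ i, √(V - m i) = √V * √(1 - m i / V) := fun i => by
    rw [← Real.sqrt_mul hV.le, mul_sub, mul_one, mul_div_cancel₀ _ hV.ne']
  rw [h, h, ← mul_add, mul_pow, Real.sq_sqrt hV.le]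
  have h0 : 0 ≤ √(1 - m 0 / V) + √(1 - m 1 / V) := by positivity
  exact mul_le_of_le_one_right hV.le (pow_le_one₀ h0 hhigh)

/-- No incentive compatible and individually rational mechanism guarantees more than
`V - 2 √(V - m 0) √(V - m 1)`, and one that guarantees this amount has a revenue that is supported by
the affine function with the optimal multipliers. -/
theorem DirectMechanism.le_of_le_guarantee {M : DirectMechanism 2 V} (hD : M.IsDSIC)
    (hR : M.IsEPIR) (hm : ∀ i, 0 < m i ∧ m i < V)
    (hhigh : √(1 - m 0 / V) + √(1 - m 1 / V) ≤ 1) {g : ℝ} (hgV : g ≤ V)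
    (hg : (g : EReal) ≤ M.guarantee m) :
    g ≤ V - 2 * √(V - m 0) * √(V - m 1) ∧
      (g = V - 2 * √(V - m 0) * √(V - m 1) → ∀ v : Profile 2 V,
        ∑ i, lamStar V m i * ((v i : ℝ) - rStar V m i) ≤ M.revenue v) := by
  have hV : 0 < V := (hm 0).1.trans (hm 0).2
  obtain ⟨lam, hlam⟩ := M.exists_affine_minorant hm (hR.revenue_le hV.le) hgV hg
  have h : ∀ i, 0 < √(V - m i) := fun i => Real.sqrt_pos.2 (by linarith [(hm i).2])
  have hs : ∀ i, V - √(V - m i) ^ 2 = m i := fun i => by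
    rw [Real.sq_sqrt (by linarith [(hm i).2])]; ring
  have hvec : ∀ a b : Set.Icc (0 : ℝ) V, g + lam 0 * ((a : ℝ) - m 0) + lam 1 * ((b : ℝ) - m 1)
      ≤ M.revenue ![a, b] := fun a b => by
    have := hlam ![a, b]
    rw [Fin.sum_univ_two] at this
    simpa [add_assoc] using this
  obtain ⟨hle, heq⟩ := value_le hV (h 0) (h 1) (sq_add_le hm hhigh)
    (x := lam 0) (y := lam 1) (g := g) (fun _ _ => rfl) (by
      intro p q hp hpV hq hqV
      rw [hs, hs]
      rcases revenue_nonpos_or_le hD hR ![⟨p, hp, hpV⟩, ⟨q, hq, hqV⟩] with h | ⟨i, hi⟩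
      · exact Or.inl ((hvec _ _).trans h)
      · refine Or.inr ?_
        match i with
        | 0 =>
          refine Or.inl fun w hw hwV => ?_
          have h1 := hi ⟨w, hp.trans hw, hwV⟩ hw
          have h2 := hvec ⟨w, hp.trans hw, hwV⟩ ⟨q, hq, hqV⟩
          have h3 : Function.update ![(⟨p, hp, hpV⟩ : Set.Icc (0 : ℝ) V), ⟨q, hq, hqV⟩] 0
              ⟨w, hp.trans hw, hwV⟩ = ![⟨w, hp.trans hw, hwV⟩, ⟨q, hq, hqV⟩] := by
            ext j; fin_cases j <;> simp
          rw [h3] at h1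
          exact h2.trans h1
        | 1 =>
          refine Or.inr fun w hw hwV => ?_
          have h1 := hi ⟨w, hq.trans hw, hwV⟩ hw
          have h2 := hvec ⟨p, hp, hpV⟩ ⟨w, hq.trans hw, hwV⟩
          have h3 : Function.update ![(⟨p, hp, hpV⟩ : Set.Icc (0 : ℝ) V), ⟨q, hq, hqV⟩] 1
              ⟨w, hq.trans hw, hwV⟩ = ![⟨p, hp, hpV⟩, ⟨w, hq.trans hw, hwV⟩] := by
            ext j; fin_cases j <;> simp
          rw [h3] at h1
          exact h2.trans h1)
  refine ⟨hle, fun he v => ?_⟩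
  obtain ⟨h0, h1⟩ := heq he
  have hl : lam = lamStar V m := by
    ext i
    rw [lamStar_eq fun i => (hm i).2, eq_div_iff (h i).ne']
    match i with
    | 0 => exact h0
    | 1 => exact h1
  -- The slopes and the value at `m` determine the minorant, so it equals `L`.
  have := hlam v
  rw [he, ← sum_lamStar_mul hm, hl, ← Finset.sum_add_distrib] at this
  refine le_of_eq_of_le (Finset.sum_congr rfl fun i _ => ?_) this
  ring

theorem DirectMechanism.IsGivenBy.value_le_guarantee {M : DirectMechanism 2 V}
    {p : Fin 2 → Set.Icc (0 : ℝ) V → Set.Icc (0 : ℝ) V} (h : M.IsGivenBy p)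
    (hm : ∀ i, 0 < m i ∧ m i < V)
    (hc : ThresholdConditions V (lamStar V m) (rStar V m) p) :
    ((V - 2 * √(V - m 0) * √(V - m 1) : ℝ) : EReal) ≤ M.guarantee m := by
  have hV : 0 < V := (hm 0).1.trans (hm 0).2
  refine M.le_guarantee (lam := lamStar V m) (h.abs_revenue_le hV.le) fun v => ?_
  refine le_of_eq_of_le ?_ (h.minorant_le (isBalanced_star hm) hc v)
  rw [← sum_lamStar_mul hm, ← Finset.sum_add_distrib]
  exact Finset.sum_congr rfl fun i _ => by ring

theorem DirectMechanism.guarantee_le {M : DirectMechanism 2 V} (hD : M.IsDSIC)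
    (hR : M.IsEPIR) (hm : ∀ i, 0 < m i ∧ m i < V)
    (hhigh : √(1 - m 0 / V) + √(1 - m 1 / V) ≤ 1) :
    M.guarantee m ≤ ((V - 2 * √(V - m 0) * √(V - m 1) : ℝ) : EReal) := by
  by_contra! hlt
  obtain ⟨g, hg1, hg2⟩ := EReal.lt_iff_exists_real_btwn.1 hlt
  have hab : 0 < √(V - m 0) * √(V - m 1) :=
    mul_pos (Real.sqrt_pos.2 (by linarith [(hm 0).2])) (Real.sqrt_pos.2 (by linarith [(hm 1).2]))
  -- Truncating `g` at `V` meets the hypothesis `g ≤ V`; the minimum still exceeds the bound, which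
  -- is strictly below `V`.
  have h := (M.le_of_le_guarantee hD hR hm hhigh (min_le_right g V)
    ((EReal.coe_le_coe_iff.2 (min_le_left g V)).trans hg2.le)).1
  rw [EReal.coe_lt_coe_iff] at hg1
  exact absurd h (not_le.2 (lt_min hg1 (by linarith)))

theorem DirectMechanism.IsGivenBy.isOptimal_iff {M : DirectMechanism 2 V}
    {p : Fin 2 → Set.Icc (0 : ℝ) V → Set.Icc (0 : ℝ) V} (h : M.IsGivenBy p)
    (hm : ∀ i, 0 < m i ∧ m i < V)
    (hhigh : √(1 - m 0 / V) + √(1 - m 1 / V) ≤ 1) :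
    M.IsOptimal m ↔ ThresholdConditions V (lamStar V m) (rStar V m) p := by
  have hV : 0 < V := (hm 0).1.trans (hm 0).2
  have hb := isBalanced_star hm
  constructor
  · rintro ⟨⟨hD, hR⟩, hopt⟩
    have hk := kinkedAuction_isGivenBy hb
    -- An optimal mechanism guarantees at least as much as the kinked auction, hence `V - 2ab`.
    have hg := (hk.value_le_guarantee hm (thresholdConditions_kinkedThreshold hb)).trans
      (hopt _ hk.isDSIC hk.isEPIR)
    have hab : 0 ≤ √(V - m 0) * √(V - m 1) := by positivity
    exact h.thresholdConditions hb hV.le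
      ((M.le_of_le_guarantee hD hR hm hhigh (by linarith) hg).2 rfl)
  · intro hc
    exact ⟨⟨h.isDSIC, h.isEPIR⟩, fun M' hD hR =>
      (M'.guarantee_le hD hR hm hhigh).trans (h.value_le_guarantee hm hc)⟩

end star

end RobustAuction

theorem mainTheorem6 (V : ℝ) (hV : 0 < V) (m : Fin 2 → ℝ)
    (hm : ∀ i, 0 < m i ∧ m i < V)
    (hhigh : √(1 - m 0 / V) + √(1 - m 1 / V) ≤ 1) :
    RobustAuction.lamStar V m 0 * RobustAuction.lamStar V m 1 = 1 ∧
    ∀ (p : Fin 2 → Set.Icc (0 : ℝ) V → Set.Icc (0 : ℝ) V)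
      (M : RobustAuction.DirectMechanism 2 V), M.IsGivenBy p →
      (M.IsOptimal m ↔
        (∀ (i : Fin 2) (w : Set.Icc (0 : ℝ) V), RobustAuction.rStar V m i.rev ≤ (w : ℝ) →
          (p i w : ℝ) = RobustAuction.rStar V m i
            + RobustAuction.lamStar V m i.rev * ((w : ℝ) - RobustAuction.rStar V m i.rev)) ∧
        (∀ (i : Fin 2) (w : Set.Icc (0 : ℝ) V),
          RobustAuction.rStar V m i
            + RobustAuction.lamStar V m i.rev * ((w : ℝ) - RobustAuction.rStar V m i.rev)
            ≤ (p i w : ℝ)) ∧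
        (∀ (i : Fin 2) (w : Set.Icc (0 : ℝ) V), (w : ℝ) ≤ RobustAuction.rStar V m i.rev →
          (p i w : ℝ) ≤
            (RobustAuction.lamStar V m 0 * RobustAuction.rStar V m 0
              + RobustAuction.lamStar V m 1 * RobustAuction.rStar V m 1
              - RobustAuction.lamStar V m i.rev * (w : ℝ)) / RobustAuction.lamStar V m i)) := by
  refine ⟨(RobustAuction.isBalanced_star hm).lam_mul_lam_rev 0, fun p M hM => ?_⟩
  rw [hM.isOptimal_iff hm hhigh]
  exact ⟨fun h => ⟨h.eq_line, h.line_le, h.le_cap⟩, fun h => ⟨h.1, h.2.1, h.2.2⟩⟩
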